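/- Let $\Sigma$ be an alphabet with at least two letters. A word $w$ over $\Sigma$ is called bordered if some nonempty proper prefix of $w$ (that is, a prefix different from $w$ itself) is also a suffix of $w$; otherwise $w$ is unbordered. Then the language of all unbordered words over $\Sigma$ is not context-free. -/

import Mathlib

/-- A word is bordered if some nonempty proper prefix of it is also a suffix of it. -/
def IsBordered {α : Type*} (w : List α) : Prop :=
  ∃ x : List α, x ≠ [] ∧ x ≠ w ∧ x <+: w ∧ x <:+ w

/-- The language of all unbordered words over the alphabet `α`. -/
def unborderedWords (α : Type*) : Language α :=
  {w : List α | ¬ IsBordered w}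

/-! Apply Ogden's lemma to `aⁱbaʲbaᵏbaⁿb` with only the last block `aⁿ` marked, where `n` is the
Ogden constant, `i = n + 1`, `j = n + n!` and `k = i + n! * i`. This word is unbordered
(`not_isBordered_fourBlocks`), and pumping creates a border.

If `u` and `v` carry marks, everything after `u` lies in the last block: pumping either removes the
final `b`, leaving the border `a`, or makes the last block so long that `aⁱb` is a border
(`exists_isBordered_pump_of_last_block`). If `y` and `z` carry marks, then `y = aᵗ` with `0 < t ≤
n`. When `uv` reaches the first `b`, pumping up keeps the prefix `aⁱb` and lengthens the last block
past `i`. Otherwise `v` lies in the first block, and `n!/t` extra copies give the last block length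
exactly `j` while the first stays at most `k`, so the first two blocks form a border
(`exists_isBordered_pump_of_fourBlocks`).

Ogden's lemma itself is a pigeonhole on the branching nodes of a path in a parse tree
(`hasPump_of_visits`). -/

namespace ContextFreeGrammar

/-! ### Parse forests with a size -/

variable {T : Type*} {g : ContextFreeGrammar T}

/-- `g.Yields n s w`: the sentential form `s` derives the terminal word `w` by a forest of parse
trees with `n` inner nodes. -/
inductive Yields (g : ContextFreeGrammar T) : ℕ → List (Symbol T g.NT) → List T → Prop
  | nil : Yields g 0 [] []
  | terminal (t : T) {n : ℕ} {s : List (Symbol T g.NT)} {w : List T} (h : Yields g n s w) :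
      Yields g n (Symbol.terminal t :: s) (t :: w)
  | nonterminal (r : ContextFreeRule T g.NT) (hr : r ∈ g.rules) {m n : ℕ}
      {s : List (Symbol T g.NT)} {v w : List T} (hv : Yields g m r.output v)
      (hw : Yields g n s w) :
      Yields g (m + n + 1) (Symbol.nonterminal r.input :: s) (v ++ w)

lemma Yields.append {m n : ℕ} {s t : List (Symbol T g.NT)} {v w : List T}
    (hs : g.Yields m s v) (ht : g.Yields n t w) : g.Yields (m + n) (s ++ t) (v ++ w) := by
  induction hs with
  | nil => simpa using ht
  | terminal a _ ih => exact ih.terminal a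
  | @nonterminal r hr m' n' s v' w' hv _ _ ih =>
    have := Yields.nonterminal r hr hv ih
    rw [List.append_assoc, show m' + n' + 1 + n = m' + (n' + n) + 1 by omega]
    exact this

/-- The size bounds make the induction on tree size in `Yields.exists_branching` possible. -/
lemma Yields.exists_of_append {n : ℕ} {s t : List (Symbol T g.NT)} {w : List T}
    (h : g.Yields n (s ++ t) w) :
    ∃ m₁ m₂ w₁ w₂, w = w₁ ++ w₂ ∧ g.Yields m₁ s w₁ ∧ g.Yields m₂ t w₂ ∧ m₁ ≤ n ∧ m₂ ≤ n := by
  induction s generalizing n w with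
  | nil => exact ⟨0, n, [], w, rfl, .nil, h, by omega, le_rfl⟩
  | cons X s ih =>
    rw [List.cons_append] at h
    cases h with
    | terminal a h =>
      obtain ⟨m₁, m₂, w₁, w₂, rfl, h₁, h₂, hm₁, hm₂⟩ := ih h
      exact ⟨m₁, m₂, a :: w₁, w₂, rfl, h₁.terminal a, h₂, hm₁, hm₂⟩
    | @nonterminal r hr m' n' _ v' w' hv hw =>
      obtain ⟨m₁, m₂, w₁, w₂, rfl, h₁, h₂, hm₁, hm₂⟩ := ih hw
      exact ⟨_, m₂, _, w₂, (List.append_assoc ..).symm, .nonterminal r hr hv h₁, h₂,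
        by omega, by omega⟩

lemma yields_map_terminal (w : List T) : g.Yields 0 (w.map Symbol.terminal) w := by
  induction w with
  | nil => exact .nil
  | cons a w ih => exact ih.terminal a

lemma Yields.derives {n : ℕ} {s : List (Symbol T g.NT)} {w : List T} (h : g.Yields n s w) :
    g.Derives s (w.map Symbol.terminal) := by
  induction h with
  | nil => exact Derives.refl _
  | terminal a _ ih => exact ih.append_left [Symbol.terminal a]
  | @nonterminal r hr m n s v w hv hw ihv ihw =>
    have h₁ : g.Produces (Symbol.nonterminal r.input :: s) (r.output ++ s) :=
      ⟨r, hr, .head s⟩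
    rw [List.map_append]
    exact h₁.trans_derives ((ihv.append_right s).trans (ihw.append_left _))

lemma Derives.exists_yields {s : List (Symbol T g.NT)} {w : List T}
    (h : g.Derives s (w.map Symbol.terminal)) : ∃ n, g.Yields n s w := by
  induction h using Relation.ReflTransGen.head_induction_on with
  | refl => exact ⟨0, yields_map_terminal w⟩
  | head h _ ih =>
    obtain ⟨n, ih⟩ := ih
    obtain ⟨r, hr, h⟩ := h
    obtain ⟨p, q, rfl, rfl⟩ := h.exists_parts
    obtain ⟨m₁, m₂, w₁, w₂, rfl, h₁, h₂, -, -⟩ := ih.exists_of_append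
    obtain ⟨m₃, m₄, w₃, w₄, rfl, h₃, h₄, -, -⟩ := h₁.exists_of_append
    have := (h₃.append (Yields.nonterminal r hr h₄ .nil)).append h₂
    rw [List.append_nil] at this
    exact ⟨_, this⟩

/-! ### Marked words and Ogden's lemma -/

/-- The terminal sentential form spelled by a marked word. -/
abbrev unmark (N : Type*) (w : List (T × Bool)) : List (Symbol T N) :=
  (w.map Prod.fst).map Symbol.terminal

/-- The number of marked positions of a marked word. -/
abbrev marks (w : List (T × Bool)) : ℕ := w.countP Prod.snd

/-- Some symbol of a sentential form yields more than its share of the marked positions. -/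
lemma Yields.exists_symbol_marks_lt {n k : ℕ} {s : List (Symbol T g.NT)}
    {w : List (T × Bool)} (h : g.Yields n s (w.map Prod.fst)) (hk : k * s.length < marks w) :
    ∃ X u x z m, w = u ++ x ++ z ∧ g.Derives s (unmark g.NT u ++ [X] ++ unmark g.NT z) ∧
      g.Yields m [X] (x.map Prod.fst) ∧ m ≤ n ∧ k < marks x := by
  induction s generalizing n w with
  | nil =>
    cases h' : w with
    | nil => simp [h'] at hk
    | cons a w => rw [h'] at h; cases h
  | cons X s ih =>
    obtain ⟨m₁, m₂, w₁, w₂, hw, h₁, h₂, hm₁, hm₂⟩ :=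
      Yields.exists_of_append (s := [X]) (t := s) h
    obtain ⟨x, y, rfl, rfl, rfl⟩ := List.map_eq_append_iff.1 hw
    by_cases hx : k < marks x
    · exact ⟨X, [], x, y, m₁, rfl, h₂.derives.append_left [X], h₁, hm₁, hx⟩
    · have hy : k * s.length < marks y := by
        simp only [marks, List.countP_append, List.length_cons, Nat.mul_add] at hk hx ⊢
        omega
      obtain ⟨Y, u, x', z, m, rfl, hd, hY, hm, hk'⟩ := ih h₂ hy
      refine ⟨Y, x ++ u, x', z, m, by simp, ?_, hY, hm.trans hm₂, hk'⟩
      have := (h₁.derives.append_right s).trans (hd.append_left _)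
      simpa [unmark] using this

/-- A parse tree with many marked leaves has a subtree which keeps a large part of them, but not
all. -/
lemma Yields.exists_branching {d k : ℕ} (hd : ∀ r ∈ g.rules, r.output.length ≤ d) (hk : 0 < k)
    {n : ℕ} {A : g.NT} {w : List (T × Bool)}
    (h : g.Yields n [Symbol.nonterminal A] (w.map Prod.fst)) (hw : k * d < marks w) :
    ∃ B u x z m, w = u ++ x ++ z ∧
      g.Derives [Symbol.nonterminal A]
        (unmark g.NT u ++ [Symbol.nonterminal B] ++ unmark g.NT z) ∧
      g.Yields m [Symbol.nonterminal B] (x.map Prod.fst) ∧ k < marks x ∧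
      (0 < marks u ∨ 0 < marks z) := by
  induction n using Nat.strong_induction_on generalizing A w with
  | _ n ih =>
    generalize hw' : w.map Prod.fst = w' at h
    cases h with
    | @nonterminal r hr m' n' _ v' w'' hv hnil =>
      cases hnil
      rw [List.append_nil] at hw'
      subst hw'
      obtain ⟨X, u, x, z, m, rfl, hder, hX, hm, hx⟩ := hv.exists_symbol_marks_lt
        (lt_of_le_of_lt (Nat.mul_le_mul_left k (hd r hr)) hw)
      have hder' : g.Derives [Symbol.nonterminal r.input]
          (unmark g.NT u ++ [X] ++ unmark g.NT z) :=
        Produces.trans_derives ⟨r, hr, ContextFreeRule.Rewrites.input_output⟩ hder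
      cases X with
      -- A leaf carries at most one mark, but `x` has more than `k ≥ 1`.
      | terminal a =>
        exfalso
        have hl : x.length = 1 := by
          generalize hx' : x.map Prod.fst = x' at hX
          cases hX with
          | terminal a h => cases h; simpa using congrArg List.length hx'
        have : marks x ≤ x.length := List.countP_le_length
        omega
      | nonterminal B =>
        by_cases hb : 0 < marks u ∨ 0 < marks z
        · exact ⟨B, u, x, z, m, rfl, hder', hX, hx, hb⟩
        -- Here every mark of the word lies in `x`, so the search continues in a smaller tree with
        -- no marks lost.
        · obtain ⟨C, u', x', z', m', rfl, hder₂, hC, hx', hb'⟩ := ih m (by omega) hX (by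
            simp only [marks, List.countP_append] at hw hb ⊢
            omega)
          refine ⟨C, u ++ u', x', z' ++ z, m', by simp, ?_, hC, hx', ?_⟩
          · have := hder'.trans ((hder₂.append_left (unmark g.NT u)).append_right (unmark g.NT z))
            simpa [unmark] using this
          · simp only [marks, List.countP_append] at hb' ⊢
            omega

/-- The marked word `w` splits as `u ++ v ++ x ++ y ++ z` along a repeated nonterminal of a parse
tree, with marked positions distributed as in Ogden's lemma. -/
def HasPump (g : ContextFreeGrammar T) (A : g.NT) (w : List (T × Bool)) : Prop :=
  ∃ (C : g.NT) (u v x y z : List (T × Bool)), w = u ++ v ++ x ++ y ++ z ∧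
    g.Derives [Symbol.nonterminal A]
      (unmark g.NT u ++ [Symbol.nonterminal C] ++ unmark g.NT z) ∧
    g.Derives [Symbol.nonterminal C]
      (unmark g.NT v ++ [Symbol.nonterminal C] ++ unmark g.NT y) ∧
    g.Derives [Symbol.nonterminal C] (unmark g.NT x) ∧
    0 < marks x ∧ (0 < marks u ∧ 0 < marks v ∨ 0 < marks y ∧ 0 < marks z)

/-- The path from `A` down to `B`, which spells `u` to its left and `z` to its right, visits
every nonterminal of `S` at a node such that `P` holds for the two words spelled above it. -/
def Visits (g : ContextFreeGrammar T) (A B : g.NT) (u z : List (T × Bool))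
    (P : List (T × Bool) → List (T × Bool) → Prop) (S : Finset g.NT) : Prop :=
  ∀ C ∈ S, ∃ u₁ u₂ z₂ z₁, u = u₁ ++ u₂ ∧ z = z₂ ++ z₁ ∧
    g.Derives [Symbol.nonterminal A]
      (unmark g.NT u₁ ++ [Symbol.nonterminal C] ++ unmark g.NT z₁) ∧
    g.Derives [Symbol.nonterminal C]
      (unmark g.NT u₂ ++ [Symbol.nonterminal B] ++ unmark g.NT z₂) ∧ P u₁ z₁

lemma derives_context_trans {A B C : g.NT} {u u' z z' : List (T × Bool)}
    (h : g.Derives [Symbol.nonterminal A]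
      (unmark g.NT u ++ [Symbol.nonterminal B] ++ unmark g.NT z))
    (h' : g.Derives [Symbol.nonterminal B]
      (unmark g.NT u' ++ [Symbol.nonterminal C] ++ unmark g.NT z')) :
    g.Derives [Symbol.nonterminal A]
      (unmark g.NT (u ++ u') ++ [Symbol.nonterminal C] ++ unmark g.NT (z' ++ z)) := by
  have := h.trans ((h'.append_left (unmark g.NT u)).append_right (unmark g.NT z))
  simpa [unmark] using this

lemma Visits.extend {A B C : g.NT} {u u' z z' : List (T × Bool)}
    {P : List (T × Bool) → List (T × Bool) → Prop} {S : Finset g.NT}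
    (h : g.Visits A B u z P S)
    (h' : g.Derives [Symbol.nonterminal B]
      (unmark g.NT u' ++ [Symbol.nonterminal C] ++ unmark g.NT z')) :
    g.Visits A C (u ++ u') (z' ++ z) P S := by
  intro D hD
  obtain ⟨u₁, u₂, z₂, z₁, rfl, rfl, h₁, h₂, hP⟩ := h D hD
  exact ⟨u₁, u₂ ++ u', z' ++ z₂, z₁, by simp, by simp, h₁, derives_context_trans h₂ h', hP⟩

open Classical in
lemma Visits.insert {A B : g.NT} {u z : List (T × Bool)}
    {P : List (T × Bool) → List (T × Bool) → Prop} {S : Finset g.NT}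
    (h : g.Visits A B u z P S)
    (h' : g.Derives [Symbol.nonterminal A]
      (unmark g.NT u ++ [Symbol.nonterminal B] ++ unmark g.NT z)) (hP : P u z) :
    g.Visits A B u z P (insert B S) := by
  intro D hD
  rcases Finset.mem_insert.1 hD with rfl | hD
  · exact ⟨u, [], [], z, by simp, by simp, h', by simpa [unmark] using Derives.refl _, hP⟩
  · exact h D hD

open Classical in
/-- Pigeonhole principle along a path of the parse tree. -/
lemma hasPump_of_visits {d : ℕ} (hd : ∀ r ∈ g.rules, r.output.length ≤ d) (hd₀ : 0 < d)
    {A : g.NT} (j : ℕ) {B : g.NT} {n : ℕ} {u w z : List (T × Bool)} {L R : Finset g.NT}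
    (hder : g.Derives [Symbol.nonterminal A]
      (unmark g.NT u ++ [Symbol.nonterminal B] ++ unmark g.NT z))
    (hB : g.Yields n [Symbol.nonterminal B] (w.map Prod.fst)) (hw : d ^ j < marks w)
    (hL : g.Visits A B u z (fun u _ => 0 < marks u) L)
    (hR : g.Visits A B u z (fun _ z => 0 < marks z) R)
    (hLs : L ⊆ g.rules.image ContextFreeRule.input)
    (hRs : R ⊆ g.rules.image ContextFreeRule.input)
    (hj : 2 * (g.rules.image ContextFreeRule.input).card < j + L.card + R.card) :
    g.HasPump A (u ++ w ++ z) := by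
  induction j generalizing B n u w z L R with
  | zero =>
    have := Finset.card_le_card hLs
    have := Finset.card_le_card hRs
    omega
  | succ j ih =>
    obtain ⟨C, u', x, z', m, rfl, hBC, hC, hx, hmark⟩ :=
      hB.exists_branching hd (Nat.pow_pos hd₀ : 0 < d ^ j) (by rwa [pow_succ] at hw)
    have hx₀ : 0 < marks x := by omega
    have hder' := derives_context_trans hder hBC
    have hCin : C ∈ g.rules.image ContextFreeRule.input := by
      generalize x.map Prod.fst = x' at hC
      cases hC with
      | nonterminal r hr _ _ => exact Finset.mem_image_of_mem _ hr
    have hcons {S : Finset g.NT} (hS : S ⊆ g.rules.image ContextFreeRule.input) :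
        insert C S ⊆ g.rules.image ContextFreeRule.input := Finset.insert_subset hCin hS
    have hassoc : u ++ (u' ++ x ++ z') ++ z = (u ++ u') ++ x ++ (z' ++ z) := by simp
    -- `L` and `R` collect the nonterminals reached by a step that leaves a mark to the left or
    -- right. A repeat closes a pump with marks on that side; otherwise the set grows while `j`
    -- drops, so `j + L.card + R.card` is kept.
    rcases hmark with hu | hz
    · by_cases hCL : C ∈ L
      · obtain ⟨u₁, u₂, z₂, z₁, rfl, rfl, h₁, h₂, hP⟩ := hL C hCL
        refine ⟨C, u₁, u₂ ++ u', x, z' ++ z₂, z₁, by simp, h₁, derives_context_trans h₂ hBC,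
          hC.derives, hx₀, Or.inl ⟨hP, ?_⟩⟩
        simp only [marks, List.countP_append] at hu ⊢
        omega
      · rw [hassoc]
        refine ih hder' hC hx ((hL.extend hBC).insert hder' ?_) (hR.extend hBC) (hcons hLs) hRs ?_
        · simp only [marks, List.countP_append] at hu ⊢
          omega
        · rw [Finset.card_insert_of_notMem hCL]
          omega
    · by_cases hCR : C ∈ R
      · obtain ⟨u₁, u₂, z₂, z₁, rfl, rfl, h₁, h₂, hP⟩ := hR C hCR
        refine ⟨C, u₁, u₂ ++ u', x, z' ++ z₂, z₁, by simp, h₁, derives_context_trans h₂ hBC,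
          hC.derives, hx₀, Or.inr ⟨?_, hP⟩⟩
        simp only [marks, List.countP_append] at hz ⊢
        omega
      · rw [hassoc]
        refine ih hder' hC hx (hL.extend hBC) ((hR.extend hBC).insert hder' ?_) hLs (hcons hRs) ?_
        · simp only [marks, List.countP_append] at hz ⊢
          omega
        · rw [Finset.card_insert_of_notMem hCR]
          omega

lemma derives_iterate {C : g.NT} {v y : List (Symbol T g.NT)}
    (h : g.Derives [Symbol.nonterminal C] (v ++ [Symbol.nonterminal C] ++ y)) (c : ℕ) :
    g.Derives [Symbol.nonterminal C] ((List.replicate c v).flatten ++ [Symbol.nonterminal C] ++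
      (List.replicate c y).flatten) := by
  induction c with
  | zero => simpa using Derives.refl _
  | succ c ih =>
    have := h.trans ((ih.append_left v).append_right y)
    rw [List.replicate_succ, List.replicate_succ' (a := y)]
    simpa using this

end ContextFreeGrammar

open ContextFreeGrammar in
/-- **Ogden's lemma**. Marked positions are those with second component `true`. -/
theorem Language.IsContextFree.ogden {T : Type*} {L : Language T} (hL : L.IsContextFree) :
    ∃ n : ℕ, ∀ w : List (T × Bool), w.map Prod.fst ∈ L → n ≤ w.countP Prod.snd →
      ∃ u v x y z : List (T × Bool), w = u ++ v ++ x ++ y ++ z ∧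
        0 < x.countP Prod.snd ∧
        (0 < u.countP Prod.snd ∧ 0 < v.countP Prod.snd ∨
          0 < y.countP Prod.snd ∧ 0 < z.countP Prod.snd) ∧
        ∀ c : ℕ, u.map Prod.fst ++ (List.replicate c (v.map Prod.fst)).flatten ++ x.map Prod.fst ++
          (List.replicate c (y.map Prod.fst)).flatten ++ z.map Prod.fst ∈ L := by
  classical
  obtain ⟨g, rfl⟩ := hL
  -- The `+ 1` keeps `d` positive even if all rules have empty output.
  set d := g.rules.sup (fun r => r.output.length) + 1 with hd
  -- `2 * card + 1` branching steps overfill `L` and `R` together; the outer `+ 1` makes the bound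
  -- on marks strict.
  refine ⟨d ^ (2 * (g.rules.image ContextFreeRule.input).card + 1) + 1, fun w hwL hw => ?_⟩
  obtain ⟨n, hn⟩ := Derives.exists_yields hwL
  have hpump : g.HasPump g.initial ([] ++ w ++ []) :=
    hasPump_of_visits (d := d) (L := ∅) (R := ∅)
      (fun r hr => (Finset.le_sup (f := fun r => r.output.length) hr).trans (Nat.le_succ _))
      (Nat.succ_pos _) _ (Derives.refl _) hn hw (by simp [Visits]) (by simp [Visits])
      (Finset.empty_subset _) (Finset.empty_subset _) (by simp)
  obtain ⟨C, u, v, x, y, z, hwe, h₁, h₂, h₃, hx, huvyz⟩ := hpump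
  refine ⟨u, v, x, y, z, by simpa using hwe, hx, huvyz, fun c => ?_⟩
  rw [mem_language_iff]
  have h₄ := (derives_iterate h₂ c).trans ((h₃.append_left _).append_right _)
  have := h₁.trans ((h₄.append_left (unmark g.NT u)).append_right (unmark g.NT z))
  simpa [unmark, List.map_flatten] using this

/-! ### Borders of words made of blocks of `a` -/

section Borders

variable {α : Type*} {a b : α}

open List

lemma isBordered_of_append_eq {x p s : List α} (hx : x ≠ []) (hs : s ≠ []) (h : x ++ s = p ++ x) :
    IsBordered (x ++ s) :=
  ⟨x, hx, fun he => hs (by simpa using he), ⟨s, rfl⟩, ⟨p, h.symm⟩⟩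

lemma List.isPrefix_replicate_append_cons {i : ℕ} {s x : List α}
    (h : x <+: replicate i a ++ b :: s) :
    (∃ m, x = replicate m a) ∨ ∃ y, x = replicate i a ++ b :: y ∧ y <+: s := by
  induction i generalizing x with
  | zero =>
    cases x with
    | nil => exact Or.inl ⟨0, rfl⟩
    | cons c x =>
      simp only [replicate_zero, nil_append, cons_prefix_cons] at h
      exact Or.inr ⟨x, by simp [h.1], h.2⟩
  | succ i ih =>
    cases x with
    | nil => exact Or.inl ⟨0, rfl⟩
    | cons c x =>
      simp only [replicate_succ, cons_append, cons_prefix_cons] at h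
      obtain ⟨rfl, h⟩ := h
      rcases ih h with ⟨m, rfl⟩ | ⟨y, rfl, hy⟩
      · exact Or.inl ⟨m + 1, rfl⟩
      · exact Or.inr ⟨y, rfl, hy⟩

lemma List.le_of_replicate_isPrefix (hab : a ≠ b) {i l : ℕ} {s : List α}
    (h : replicate i a <+: replicate l a ++ b :: s) : i ≤ l := by
  induction i generalizing l with
  | zero => exact Nat.zero_le _
  | succ i ih =>
    cases l with
    | zero => simp [replicate_succ, cons_prefix_cons, hab] at h
    | succ l =>
      simp only [replicate_succ, cons_append, cons_prefix_cons, true_and] at h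
      exact Nat.succ_le_succ (ih h)

lemma List.replicate_append_cons_isPrefix (hab : a ≠ b) {i l : ℕ} {s t : List α}
    (h : replicate i a ++ b :: s <+: replicate l a ++ b :: t) : i = l ∧ s <+: t := by
  induction i generalizing l with
  | zero =>
    cases l with
    | zero => simpa [cons_prefix_cons] using h
    | succ l => simp [replicate_succ, cons_prefix_cons, hab.symm] at h
  | succ i ih =>
    cases l with
    | zero => simp [replicate_succ, cons_prefix_cons, hab] at h
    | succ l =>
      simp only [replicate_succ, cons_append, cons_prefix_cons, true_and] at h
      exact (ih h).imp_left (congrArg Nat.succ)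

/-- The word `aⁱbaʲbaᵏbaˡb`. -/
def fourBlocks (a b : α) (i j k l : ℕ) : List α :=
  replicate i a ++ b :: (replicate j a ++ b :: (replicate k a ++ b :: (replicate l a ++ [b])))

/-- A border must end in `b`, so it consists of the first one, two or three blocks. Comparing its
last block with `aˡ` would force `i ≤ l`, `j = l` or `k = l` respectively. -/
lemma not_isBordered_fourBlocks (hab : a ≠ b) {i j k l : ℕ} (hil : l < i) (hjl : j ≠ l)
    (hik : i ≤ k) : ¬ IsBordered (fourBlocks a b i j k l) := by
  rintro ⟨x, hx₀, hx, hpre, hsuf⟩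
  -- Reversal turns the suffix condition into a prefix condition, to be read off block by block.
  have hrev := reverse_prefix.2 hsuf
  simp only [fourBlocks, reverse_append, reverse_cons, reverse_replicate, reverse_nil,
    nil_append, append_assoc, cons_append] at hrev
  rcases isPrefix_replicate_append_cons hpre with ⟨m, rfl⟩ | ⟨y1, rfl, hy1⟩
  · cases m with
    | zero => simp at hx₀
    | succ m =>
      rw [reverse_replicate, replicate_succ] at hrev
      simp [cons_prefix_cons, hab] at hrev
  simp only [reverse_append, reverse_cons, reverse_replicate, append_assoc, cons_append,
    nil_append] at hrev
  rcases isPrefix_replicate_append_cons hy1 with ⟨m, rfl⟩ | ⟨y2, rfl, hy2⟩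
  · cases m with
    | zero =>
      simp only [replicate_zero, reverse_nil, nil_append, cons_prefix_cons, true_and] at hrev
      exact absurd (le_of_replicate_isPrefix hab hrev) (by omega)
    | succ m =>
      rw [reverse_replicate, replicate_succ] at hrev
      simp [cons_prefix_cons, hab] at hrev
  simp only [reverse_append, reverse_cons, reverse_replicate, append_assoc, cons_append,
    nil_append] at hrev
  rcases isPrefix_replicate_append_cons hy2 with ⟨m, rfl⟩ | ⟨y3, rfl, hy3⟩
  · cases m with
    | zero =>
      simp only [replicate_zero, reverse_nil, nil_append, cons_prefix_cons, true_and] at hrev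
      exact hjl (replicate_append_cons_isPrefix hab hrev).1
    | succ m =>
      rw [reverse_replicate, replicate_succ] at hrev
      simp [cons_prefix_cons, hab] at hrev
  simp only [reverse_append, reverse_cons, reverse_replicate, append_assoc, cons_append,
    nil_append] at hrev
  rcases isPrefix_replicate_append_cons (s := []) hy3 with ⟨m, rfl⟩ | ⟨y4, rfl, hy4⟩
  · cases m with
    | zero =>
      simp only [replicate_zero, reverse_nil, nil_append, cons_prefix_cons, true_and] at hrev
      have := (replicate_append_cons_isPrefix hab hrev).1
      omega
    | succ m =>
      rw [reverse_replicate, replicate_succ] at hrev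
      simp [cons_prefix_cons, hab] at hrev
  · rw [prefix_nil] at hy4
    subst hy4
    exact hx rfl

/-- A word that starts with `aⁱb` is bordered if it ends with `aᵐb` for some `m ≥ i`. -/
lemma isBordered_of_long_last_block {i m : ℕ} (him : i ≤ m) (s : List α) :
    IsBordered (replicate i a ++ b :: (s ++ replicate m a ++ [b])) := by
  obtain ⟨e, rfl⟩ := Nat.exists_eq_add_of_le' him
  have h : replicate i a ++ b :: (s ++ replicate (e + i) a ++ [b]) =
      (replicate i a ++ [b]) ++ (s ++ replicate (e + i) a ++ [b]) := by simp
  rw [h]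
  refine isBordered_of_append_eq (p := replicate i a ++ [b] ++ s ++ replicate e a)
    (by simp) (by simp) ?_
  simp only [← replicate_append_replicate, append_assoc, cons_append, nil_append]

lemma isBordered_of_last_letter (s : List α) : IsBordered (a :: (s ++ [a])) :=
  isBordered_of_append_eq (x := [a]) (s := s ++ [a]) (p := a :: s) (by simp) (by simp) (by simp)

/-- The border is `aⁱbaʲb`: its first block fits at the end of `aᵏ`. -/
lemma isBordered_fourBlocks {i j k : ℕ} (hik : i ≤ k) :
    IsBordered (fourBlocks a b i j k j) := by
  obtain ⟨e, rfl⟩ := Nat.exists_eq_add_of_le' hik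
  have h : fourBlocks a b i j (e + i) j = (replicate i a ++ b :: (replicate j a ++ [b])) ++
      (replicate (e + i) a ++ b :: (replicate j a ++ [b])) := by simp [fourBlocks]
  rw [h]
  refine isBordered_of_append_eq
    (p := replicate i a ++ b :: (replicate j a ++ b :: replicate e a)) (by simp) (by simp) ?_
  simp only [← replicate_append_replicate, append_assoc, cons_append, nil_append]

/-- The word `uvᶜxyᶜz`. -/
def pump (u v x y z : List α) (c : ℕ) : List α :=
  u ++ (replicate c v).flatten ++ x ++ (replicate c y).flatten ++ z

lemma List.exists_eq_replicate_of_append {u v : List α} {n : ℕ} (h : u ++ v = replicate n a) :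
    ∃ p q, u = replicate p a ∧ v = replicate q a := by
  rw [append_eq_replicate_iff] at h
  exact ⟨_, _, h.2⟩

/-- Pumping inside the last block `aˡb`. -/
lemma exists_isBordered_pump_of_last_block {i l : ℕ} (hi : 0 < i) (s : List α)
    {u v x y z : List α} (hu : u ≠ []) (hv : v ≠ [])
    (h : u ++ v ++ x ++ y ++ z = replicate l a ++ [b]) :
    ∃ c, IsBordered (replicate i a ++ b :: (s ++ pump u v x y z c)) := by
  have hend (m : ℕ) (hm : 0 < m) : IsBordered (replicate i a ++ b :: (s ++ replicate m a)) := by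
    obtain ⟨i, rfl⟩ := Nat.exists_eq_succ_of_ne_zero hi.ne'
    obtain ⟨m, rfl⟩ := Nat.exists_eq_succ_of_ne_zero hm.ne'
    have := isBordered_of_last_letter (a := a) (replicate i a ++ b :: (s ++ replicate m a))
    rw [replicate_succ, replicate_succ' (n := m)]
    simpa only [append_assoc, cons_append] using this
  have hu₀ := length_pos_iff.2 hu
  have hv₀ := length_pos_iff.2 hv
  have hvi : i ≤ i * v.length := Nat.le_mul_of_pos_right i hv₀
  rcases eq_nil_or_concat' z with rfl | ⟨z, e, rfl⟩
  · rcases eq_nil_or_concat' y with rfl | ⟨y, e, rfl⟩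
    · rcases eq_nil_or_concat' x with rfl | ⟨x, e, rfl⟩
      · rcases eq_nil_or_concat' v with rfl | ⟨v, e, rfl⟩
        · exact absurd rfl hv
        · simp only [append_nil, ← append_assoc] at h
          obtain ⟨p, q, rfl, -⟩ := exists_eq_replicate_of_append (append_inj' h rfl).1
          -- The final `b` belongs to `v`, so `c = 0` deletes it.
          exact ⟨0, by simpa [pump] using hend p (by simpa using hu₀)⟩
      · simp only [append_nil, ← append_assoc] at h
        obtain ⟨h, he⟩ := append_inj' h rfl
        obtain ⟨_, r, h₁, rfl⟩ := exists_eq_replicate_of_append h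
        obtain ⟨p, q, rfl, rfl⟩ := exists_eq_replicate_of_append h₁
        rw [length_replicate] at hvi
        have := isBordered_of_long_last_block (a := a) (b := b)
          (show i ≤ p + i * q + r by omega) s
        -- `v` is nonempty, so `i` copies of it give at least `i` letters `a`.
        refine ⟨i, ?_⟩
        rw [he]
        simpa only [pump, flatten_replicate_replicate, ← replicate_append_replicate, append_assoc,
          flatten_replicate_nil, append_nil] using this
    · simp only [append_nil, ← append_assoc] at h
      obtain ⟨_, _, h₁, -⟩ := exists_eq_replicate_of_append (append_inj' h rfl).1
      obtain ⟨_, r, h₂, rfl⟩ := exists_eq_replicate_of_append h₁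
      obtain ⟨p, q, rfl, rfl⟩ := exists_eq_replicate_of_append h₂
      rw [length_replicate] at hu₀
      exact ⟨0, by simpa [pump] using hend (p + r) (by omega)⟩
  · simp only [← append_assoc] at h
    obtain ⟨h, he⟩ := append_inj' h rfl
    obtain ⟨_, t, h₁, rfl⟩ := exists_eq_replicate_of_append h
    obtain ⟨_, m, h₂, rfl⟩ := exists_eq_replicate_of_append h₁
    obtain ⟨_, r, h₃, rfl⟩ := exists_eq_replicate_of_append h₂
    obtain ⟨p, q, rfl, rfl⟩ := exists_eq_replicate_of_append h₃
    rw [length_replicate] at hvi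
    have := isBordered_of_long_last_block (a := a) (b := b)
      (show i ≤ p + i * q + r + i * m + t by omega) s
    refine ⟨i, ?_⟩
    rw [he]
    simpa only [pump, flatten_replicate_replicate, ← replicate_append_replicate, append_assoc]
      using this

lemma List.append_append_eq_append_cons {u v x r s : List α}
    (h : u ++ v ++ x = r ++ b :: s) :
    (∃ q, u ++ v = r ++ b :: q) ∨ ∃ q, r = u ++ v ++ q ∧ x = q ++ b :: s := by
  rcases append_eq_append_iff.1 h with ⟨q, rfl, hx⟩ | ⟨q, hq, hs⟩
  · exact Or.inr ⟨q, rfl, hx⟩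
  · cases q with
    | nil => exact Or.inr ⟨[], by simpa using hq.symm, by simpa using hs.symm⟩
    | cons c q =>
      rw [cons_append, cons.injEq] at hs
      exact Or.inl ⟨q, by rw [hq, hs.1]⟩

/-- Pumping before and inside the last block `aˡb`. -/
lemma exists_isBordered_pump_of_fourBlocks {i j k l l₁ l₂ t e : ℕ}
    {u v x : List α} (hi : 0 < i) (ht : 0 < t) (hl : l = l₁ + t + l₂) (hj : j = l + e * t)
    (hk : i + e * i ≤ k)
    (h : u ++ v ++ x = replicate i a ++ b ::
      (replicate j a ++ b :: (replicate k a ++ b :: replicate l₁ a))) :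
    ∃ c, IsBordered (pump u v x (replicate t a) (replicate l₂ a ++ [b]) c) := by
  rcases append_append_eq_append_cons h with ⟨q, hq⟩ | ⟨q, hq, rfl⟩
  · have hm : i ≤ i * t + l₂ := (Nat.le_mul_of_pos_right i ht).trans (Nat.le_add_right _ _)
    obtain ⟨i', rfl⟩ := Nat.exists_eq_succ_of_ne_zero hi.ne'
    -- The exponent is `i`; it is positive, so one copy of `v` stays next to `u` and preserves the
    -- prefix `aⁱb`.
    refine ⟨i' + 1, ?_⟩
    have := isBordered_of_long_last_block (a := a) (b := b) hm
      (q ++ (replicate i' v).flatten ++ x)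
    have hpump : pump u v x (replicate t a) (replicate l₂ a ++ [b]) (i' + 1) =
        (u ++ v) ++ (replicate i' v).flatten ++ x ++
          (replicate (i' + 1) (replicate t a)).flatten ++ (replicate l₂ a ++ [b]) := by
      rw [pump, replicate_succ (a := v), flatten_cons, append_assoc u v]
    rw [hpump, hq]
    simpa only [flatten_replicate_replicate, ← replicate_append_replicate (m := l₂), append_assoc,
      cons_append] using this
  · obtain ⟨_, r, huv, rfl⟩ := exists_eq_replicate_of_append hq.symm
    obtain ⟨p, m, rfl, rfl⟩ := exists_eq_replicate_of_append huv
    have hpmr : i = p + m + r := by simpa using congrArg length hq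
    have hem : e * m ≤ e * i := Nat.mul_le_mul_left e (by omega)
    -- The `e` extra copies lengthen the last block by `e * t`, to `j`, and the first by `e * m ≤ e
    -- * i`, to at most `k`.
    refine ⟨e + 1, ?_⟩
    have := isBordered_fourBlocks (a := a) (b := b) (i := p + (e + 1) * m + r) (j := j) (k := k)
      (by rw [Nat.succ_mul]; omega)
    have hj' : j = l₁ + (e + 1) * t + l₂ := by rw [Nat.succ_mul]; omega
    rw [fourBlocks] at this
    -- Only the last block is rewritten; the second one is untouched by pumping.
    nth_rw 2 [hj'] at this
    generalize e + 1 = c at this ⊢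
    simpa only [pump, flatten_replicate_replicate, ← replicate_append_replicate, append_assoc,
      cons_append] using this

end Borders

/-! ### Application to unbordered words -/

section MarkedWords

variable {α : Type*}

/-- As `p` is unmarked, a prefix containing a mark must extend beyond it. -/
lemma ContextFreeGrammar.exists_eq_append_of_marks_pos {u r s : List (α × Bool)} {p : List α}
    (h : u ++ r = p.map (fun c => (c, false)) ++ s) (hu : 0 < marks u) :
    ∃ u', u = p.map (fun c => (c, false)) ++ u' ∧ u' ≠ [] ∧ u' ++ r = s := by
  rcases List.append_eq_append_iff.1 h with ⟨q, hq, -⟩ | ⟨q, rfl, rfl⟩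
  · exfalso
    have h₀ : marks (p.map (fun c => (c, false))) = 0 := by
      simp [marks, List.countP_eq_zero]
    rw [hq] at h₀
    simp only [marks, List.countP_append] at h₀ hu
    omega
  · refine ⟨q, rfl, ?_, rfl⟩
    rintro rfl
    simp [marks] at hu

end MarkedWords

open ContextFreeGrammar in
theorem theorem6 {α : Type*} [Nontrivial α] :
    ¬ (unborderedWords α).IsContextFree := by
  intro hcf
  obtain ⟨a, b, hab⟩ := exists_pair_ne α
  obtain ⟨n, hn⟩ := hcf.ogden
  set i := n + 1 with hi
  set j := n + n.factorial with hj
  set k := i + n.factorial * i with hk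
  have hfac : 0 < n.factorial := n.factorial_pos
  set p : List α := List.replicate i a ++ b :: (List.replicate j a ++ b ::
    (List.replicate k a ++ [b])) with hp
  have hword (w : List α) : p ++ w = List.replicate i a ++ b ::
      ((List.replicate j a ++ b :: (List.replicate k a ++ [b])) ++ w) := by simp [hp]
  obtain ⟨u, v, x, y, z, hw, hx, hmark, hpump⟩ := hn
    (p.map (fun c => (c, false)) ++ (List.replicate n (a, true) ++ [(b, false)]))
    (by
      have := not_isBordered_fourBlocks hab (i := i) (j := j) (k := k) (l := n) (by omega)
        (by omega) (Nat.le_add_right _ _)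
      change ¬ IsBordered _
      simpa [fourBlocks, hp, Function.comp_def] using this)
    (by simp [List.countP_replicate, List.countP_append])
  rcases hmark with ⟨hu, hv⟩ | ⟨hy, hz⟩
  · obtain ⟨u, rfl, hu₀, h⟩ := exists_eq_append_of_marks_pos (u := u) (r := v ++ x ++ y ++ z)
      (by rw [hw]; simp only [List.append_assoc]) hu
    have hv₀ : v ≠ [] := by rintro rfl; simp at hv
    obtain ⟨c, hc⟩ := exists_isBordered_pump_of_last_block (a := a) (b := b) (i := i) (l := n)
      (u := u.map Prod.fst) (v := v.map Prod.fst) (x := x.map Prod.fst) (y := y.map Prod.fst)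
      (z := z.map Prod.fst) (by omega)
      (List.replicate j a ++ b :: (List.replicate k a ++ [b])) (by simpa using hu₀)
      (by simpa using hv₀) (by simpa using congrArg (List.map Prod.fst) h)
    rw [← hword] at hc
    refine hpump c ?_
    simpa [pump, Function.comp_def] using hc
  -- The mark in `x` forces `u ++ v ++ x` past `p`, so `y` and `z` lie in the last block.
  · obtain ⟨q, hq, -, h⟩ := exists_eq_append_of_marks_pos (u := u ++ v ++ x) (r := y ++ z)
      (by rw [hw]; simp only [List.append_assoc]) (by
        simp only [marks, List.countP_append]
        omega)
    rcases List.eq_nil_or_concat' z with rfl | ⟨z, f, rfl⟩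
    · simp at hz
    simp only [← List.append_assoc] at h
    obtain ⟨h, hf⟩ := List.append_inj' h rfl
    obtain ⟨_, l₂, h', rfl⟩ := List.exists_eq_replicate_of_append h
    obtain ⟨l₁, t, rfl, rfl⟩ := List.exists_eq_replicate_of_append h'
    have hl : n = l₁ + t + l₂ := by simpa using congrArg List.length h.symm
    have ht : 0 < t := Nat.pos_of_ne_zero (by rintro rfl; simp at hy)
    -- The choice `j = n + n!` works for every possible `t ≤ n`, with `e = n!/t`.
    obtain ⟨e, he⟩ := Nat.dvd_factorial ht (show t ≤ n by omega)
    rw [mul_comm] at he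
    obtain ⟨c, hc⟩ := exists_isBordered_pump_of_fourBlocks (a := a) (b := b) (i := i) (j := j)
      (k := k) (l := n) (l₁ := l₁) (l₂ := l₂) (t := t) (e := e)
      (u := u.map Prod.fst) (v := v.map Prod.fst) (x := x.map Prod.fst) (by omega) ht hl
      (by omega)
      (Nat.add_le_add_left (Nat.mul_le_mul_right i (he ▸ Nat.le_mul_of_pos_right e ht)) i) (by
        simpa [hp, Function.comp_def] using congrArg (List.map Prod.fst) hq)
    refine hpump c ?_
    obtain rfl : f = (b, false) := by simpa using hf
    simpa [pump] using hc
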